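/- For $n\ge 1$, a polygonal curve of length $n$ in $\mathbb{R}$ is a continuous function $P:[1,n]\to\mathbb{R}$ with $P(i+\lambda)=(1-\lambda)P(i)+\lambda P(i+1)$ for all integers $1\le i\le n-1$ and all $\lambda\in[0,1]$; its vertices are $P(1),\dots,P(n)$. For two such curves $P,Q$, the (continuous) flipped Fréchet measure is $$FF(P,Q)=\sup_{(f,g)}\ \min_{t\in[0,1]}|P(f(t))-Q(g(t))|,$$ where the supremum is over all pairs of continuous, non-decreasing, surjective functions $f,g:[0,1]\to[1,n]$. Theorem. There is a (deterministic) algorithm on the real RAM that, given $n\ge 1$ and the vertices of any two polygonal curves $P,Q$ of length $n$ in $\mathbb{R}$, computes $FF(P,Q)$ exactly in $O(n\log^2 n)$ time. Here the real RAM is the standard unit-cost machine: memory cells hold natural numbers or exact real numbers; reals can be added, subtracted, multiplied, divided and compared (integer constants only, no rounding); natural numbers, used for indices and counters, can be added, subtracted, halved and compared; indirect addressing is allowed; every primitive operation takes one step. -/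

import Mathlib

open Set Filter

/-! ### Polygonal curves, traversals, and the flipped Fréchet measure -/

section Curves

variable {E : Type*} [NormedAddCommGroup E] [NormedSpace ℝ E]

/-- `P` is a polygonal curve of length `n`: it is continuous on `[1, n]` and, for every integer
`1 ≤ i ≤ n - 1`, its restriction to `[i, i+1]` is the (affinely parametrised) line segment from
the vertex `P i` to the vertex `P (i+1)`. Values outside `[1, n]` are irrelevant. -/
def IsPolygonalCurve (n : ℕ) (P : ℝ → E) : Prop :=
  ContinuousOn P (Icc 1 (n : ℝ)) ∧
    ∀ i : ℕ, 1 ≤ i → i < n → ∀ l ∈ Icc (0 : ℝ) 1,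
      P ((i : ℝ) + l) = (1 - l) • P (i : ℝ) + l • P ((i : ℝ) + 1)

/-- A traversal of a curve of length `n`: a continuous, non-decreasing map from `[0, 1]`
onto `[1, n]`. -/
def IsTraversal (n : ℕ) (f : ℝ → ℝ) : Prop :=
  ContinuousOn f (Icc 0 1) ∧ MonotoneOn f (Icc 0 1) ∧ f '' Icc 0 1 = Icc 1 (n : ℝ)

/-- The separations realised by the traversals `(f, g)` of the pair `P, Q`, that is, the numbers
`min_{t ∈ [0,1]} ‖P (f t) - Q (g t)‖`. -/
def separations (n m : ℕ) (P Q : ℝ → E) : Set ℝ :=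
  {d | ∃ f g : ℝ → ℝ, IsTraversal n f ∧ IsTraversal m g ∧
    IsLeast ((fun t => ‖P (f t) - Q (g t)‖) '' Icc (0 : ℝ) 1) d}

/-- The flipped Fréchet measure `FF(P, Q) = sup_{(f,g)} min_{t ∈ [0,1]} ‖P (f t) - Q (g t)‖`. -/
noncomputable def flippedFrechet (n m : ℕ) (P Q : ℝ → E) : ℝ :=
  sSup (separations n m P Q)

theorem IsTraversal.apply_zero {n : ℕ} {f : ℝ → ℝ} (hn : 1 ≤ n) (hf : IsTraversal n f) :
    f 0 = 1 := by
  obtain ⟨-, hm, hs⟩ := hf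
  have h0 : (0 : ℝ) ∈ Icc (0 : ℝ) 1 := by simp
  have h1 : (1 : ℝ) ∈ Icc (1 : ℝ) (n : ℝ) := ⟨le_rfl, by exact_mod_cast hn⟩
  have h2 : f 0 ∈ Icc (1 : ℝ) (n : ℝ) := hs ▸ mem_image_of_mem f h0
  rw [← hs] at h1
  obtain ⟨t, ht, hft⟩ := h1
  exact le_antisymm (hft ▸ hm h0 ht ht.1) h2.1

theorem isTraversal_affine {n : ℕ} (hn : 1 ≤ n) :
    IsTraversal n (fun t => 1 + ((n : ℝ) - 1) * t) := by
  have hn' : (0 : ℝ) ≤ (n : ℝ) - 1 := by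
    have : (1 : ℝ) ≤ n := by exact_mod_cast hn
    linarith
  refine ⟨by fun_prop, fun x _ y _ h => by
    have := mul_le_mul_of_nonneg_left h hn'
    simpa using this, ?_⟩
  ext y
  constructor
  · rintro ⟨t, ⟨h0, h1⟩, rfl⟩
    constructor <;> dsimp only <;> nlinarith
  · rintro ⟨h1, h2⟩
    rcases hn'.eq_or_lt with h | h
    · exact ⟨0, by simp, by simp; linarith⟩
    · refine ⟨(y - 1) / ((n : ℝ) - 1), ⟨div_nonneg (by linarith) hn', ?_⟩, ?_⟩
      · rw [div_le_one h]; linarith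
      · dsimp only
        rw [mul_div_cancel₀ _ h.ne']; ring

/-- For polygonal curves with at least one vertex the supremum defining the flipped Fréchet measure
is a genuine least upper bound. -/
theorem isLUB_flippedFrechet {n m : ℕ} (hn : 1 ≤ n) (hm : 1 ≤ m) {P Q : ℝ → E}
    (hP : IsPolygonalCurve n P) (hQ : IsPolygonalCurve m Q) :
    IsLUB (separations n m P Q) (flippedFrechet n m P Q) := by
  apply isLUB_csSup
  · have hf := isTraversal_affine hn
    have hg := isTraversal_affine hm
    have hPc := hP.1.comp hf.1 (fun t ht => hf.2.2 ▸ mem_image_of_mem _ ht)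
    have hQc := hQ.1.comp hg.1 (fun t ht => hg.2.2 ▸ mem_image_of_mem _ ht)
    have hc := (hPc.sub hQc).norm
    obtain ⟨d, hd⟩ := (isCompact_Icc.image_of_continuousOn hc).exists_isLeast
      (Set.Nonempty.image _ ⟨0, by simp⟩)
    exact ⟨d, _, _, hf, hg, hd⟩
  · refine ⟨‖P 1 - Q 1‖, ?_⟩
    rintro d ⟨f, g, hf, hg, hd⟩
    have := hd.2 (mem_image_of_mem _ (show (0 : ℝ) ∈ Icc (0 : ℝ) 1 by simp))
    simpa [hf.apply_zero hn, hg.apply_zero hm] using this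

end Curves

/-! ### The real RAM

The memory holds arrays of natural numbers (for indices and counters) and arrays of real numbers.
Programs are while-programs; every primitive operation (constant, memory access with indirect
addressing, arithmetic operation, comparison, assignment, test) has unit cost. Reals are exact;
they support only `+`, `-`, `*`, `/` and comparison, the only real constants are integers, and there
is no rounding and no other way to turn a real into a natural number (`x / 0` is `0`). Natural numbers support only
addition, truncated subtraction, halving and comparison. -/

namespace RealRAM

/-- A memory state: `nat a i` and `real a i` are the contents of cell `i` of the natural-number array
`a` and of the real array `a`. -/
structure State where
  nat : ℕ → ℕ → ℕ
  real : ℕ → ℕ → ℝ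

/-- Natural-number expressions; `get a e` reads the cell with index `e` of the array `a`. -/
inductive NExp where
  | const (k : ℕ)
  | get (a : ℕ) (e : NExp)
  | add (e₁ e₂ : NExp)
  | sub (e₁ e₂ : NExp)
  | half (e : NExp)

namespace NExp

def eval (s : State) : NExp → ℕ
  | const k => k
  | get a e => s.nat a (e.eval s)
  | add e₁ e₂ => e₁.eval s + e₂.eval s
  | sub e₁ e₂ => e₁.eval s - e₂.eval s
  | half e => e.eval s / 2

/-- The number of primitive operations in an expression. -/
def cost : NExp → ℕ
  | const _ => 1
  | get _ e => e.cost + 1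
  | add e₁ e₂ => e₁.cost + e₂.cost + 1
  | sub e₁ e₂ => e₁.cost + e₂.cost + 1
  | half e => e.cost + 1

end NExp

/-- Real expressions; `get a e` reads the cell with index `e` of the real array `a`. -/
inductive RExp where
  | const (k : ℤ)
  | get (a : ℕ) (e : NExp)
  | add (e₁ e₂ : RExp)
  | sub (e₁ e₂ : RExp)
  | mul (e₁ e₂ : RExp)
  | div (e₁ e₂ : RExp)

namespace RExp

noncomputable def eval (s : State) : RExp → ℝ
  | const k => (k : ℝ)
  | get a e => s.real a (e.eval s)
  | add e₁ e₂ => e₁.eval s + e₂.eval s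
  | sub e₁ e₂ => e₁.eval s - e₂.eval s
  | mul e₁ e₂ => e₁.eval s * e₂.eval s
  | div e₁ e₂ => e₁.eval s / e₂.eval s

/-- The number of primitive operations in an expression. -/
def cost : RExp → ℕ
  | const _ => 1
  | get _ e => e.cost + 1
  | add e₁ e₂ => e₁.cost + e₂.cost + 1
  | sub e₁ e₂ => e₁.cost + e₂.cost + 1
  | mul e₁ e₂ => e₁.cost + e₂.cost + 1
  | div e₁ e₂ => e₁.cost + e₂.cost + 1

end RExp

/-- Tests. -/
inductive BExp where
  | natLe (e₁ e₂ : NExp)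
  | realLe (e₁ e₂ : RExp)
  | neg (b : BExp)
  | conj (b₁ b₂ : BExp)

namespace BExp

def eval (s : State) : BExp → Prop
  | natLe e₁ e₂ => e₁.eval s ≤ e₂.eval s
  | realLe e₁ e₂ => e₁.eval s ≤ e₂.eval s
  | neg b => ¬ b.eval s
  | conj b₁ b₂ => b₁.eval s ∧ b₂.eval s

/-- The number of primitive operations in a test. -/
def cost : BExp → ℕ
  | natLe e₁ e₂ => e₁.cost + e₂.cost + 1
  | realLe e₁ e₂ => e₁.cost + e₂.cost + 1
  | neg b => b.cost + 1
  | conj b₁ b₂ => b₁.cost + b₂.cost + 1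

end BExp

/-- Programs. `setNat a i e` and `setReal a i e` store the value of `e` in the cell with index `i` of
the array `a`. -/
inductive Cmd where
  | skip
  | setNat (a : ℕ) (i e : NExp)
  | setReal (a : ℕ) (i : NExp) (e : RExp)
  | seq (c₁ c₂ : Cmd)
  | ite (b : BExp) (c₁ c₂ : Cmd)
  | loop (b : BExp) (c : Cmd)

namespace State

def setNat (s : State) (a i v : ℕ) : State :=
  { s with nat := Function.update s.nat a (Function.update (s.nat a) i v) }

noncomputable def setReal (s : State) (a i : ℕ) (v : ℝ) : State :=
  { s with real := Function.update s.real a (Function.update (s.real a) i v) }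

end State

/-- `Exec c s t s'`: started in the memory state `s`, the program `c` halts after exactly `t` primitive
steps, in the memory state `s'`. -/
inductive Exec : Cmd → State → ℕ → State → Prop where
  | skip (s : State) : Exec Cmd.skip s 1 s
  | setNat (a : ℕ) (i e : NExp) (s : State) :
      Exec (Cmd.setNat a i e) s (i.cost + e.cost + 1) (s.setNat a (i.eval s) (e.eval s))
  | setReal (a : ℕ) (i : NExp) (e : RExp) (s : State) :
      Exec (Cmd.setReal a i e) s (i.cost + e.cost + 1) (s.setReal a (i.eval s) (e.eval s))
  | seq {c₁ c₂ : Cmd} {s s' s'' : State} {t₁ t₂ : ℕ} :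
      Exec c₁ s t₁ s' → Exec c₂ s' t₂ s'' → Exec (Cmd.seq c₁ c₂) s (t₁ + t₂) s''
  | iteTrue {b : BExp} {c₁ c₂ : Cmd} {s s' : State} {t : ℕ} :
      b.eval s → Exec c₁ s t s' → Exec (Cmd.ite b c₁ c₂) s (b.cost + 1 + t) s'
  | iteFalse {b : BExp} {c₁ c₂ : Cmd} {s s' : State} {t : ℕ} :
      ¬ b.eval s → Exec c₂ s t s' → Exec (Cmd.ite b c₁ c₂) s (b.cost + 1 + t) s'
  | loopFalse {b : BExp} {c : Cmd} {s : State} :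
      ¬ b.eval s → Exec (Cmd.loop b c) s (b.cost + 1) s
  | loopTrue {b : BExp} {c : Cmd} {s s' s'' : State} {t₁ t₂ : ℕ} :
      b.eval s → Exec c s t₁ s' → Exec (Cmd.loop b c) s' t₂ s'' →
        Exec (Cmd.loop b c) s (b.cost + 1 + t₁ + t₂) s''

/-- The machine is deterministic: running time and final memory are determined by the program and
the initial memory. -/
theorem Exec.deterministic {c : Cmd} {s s₁ s₂ : State} {t₁ t₂ : ℕ}
    (h₁ : Exec c s t₁ s₁) (h₂ : Exec c s t₂ s₂) : t₁ = t₂ ∧ s₁ = s₂ := by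
  induction h₁ generalizing t₂ s₂ with
  | skip | setNat | setReal => cases h₂; exact ⟨rfl, rfl⟩
  | seq _ _ ih₁ ih₂ =>
    cases h₂ with
    | seq k₁ k₂ =>
      obtain ⟨rfl, rfl⟩ := ih₁ k₁
      obtain ⟨rfl, rfl⟩ := ih₂ k₂
      exact ⟨rfl, rfl⟩
  | iteTrue hb _ ih =>
    cases h₂ with
    | iteTrue _ k => obtain ⟨rfl, rfl⟩ := ih k; exact ⟨rfl, rfl⟩
    | iteFalse hb' _ => exact absurd hb hb'
  | iteFalse hb _ ih =>
    cases h₂ with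
    | iteTrue hb' _ => exact absurd hb' hb
    | iteFalse _ k => obtain ⟨rfl, rfl⟩ := ih k; exact ⟨rfl, rfl⟩
  | loopFalse hb =>
    cases h₂ with
    | loopFalse => exact ⟨rfl, rfl⟩
    | loopTrue hb' => exact absurd hb' hb
  | loopTrue hb _ _ ih₁ ih₂ =>
    cases h₂ with
    | loopFalse hb' => exact absurd hb hb'
    | loopTrue _ k₁ k₂ =>
      obtain ⟨rfl, rfl⟩ := ih₁ k₁
      obtain ⟨rfl, rfl⟩ := ih₂ k₂
      exact ⟨rfl, rfl⟩

/-- The initial memory for two sequences of `n` reals: `n` is in cell `0` of natural-number array `0`,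
the first sequence is in cells `0, …, n-1` of real array `0`, the second one in cells
`0, …, n-1` of real array `1`, and all other cells are `0`. -/
noncomputable def input (n : ℕ) (p q : ℕ → ℝ) : State where
  nat a i := if a = 0 ∧ i = 0 then n else 0
  real a i := if i < n then (if a = 0 then p i else if a = 1 then q i else 0) else 0

/-- The output of a halted program is in cell `0` of real array `2`. -/
def output (s : State) : ℝ := s.real 2 0

end RealRAM

/-!
The optimal separation of two curves on the line is found by greedy scans of their vertices, in a
linear number of steps.

Along traversals with positive separation the difference `P (f t) - Q (g t)` never vanishes and so
has a constant sign. Therefore `flippedFrechet n n P Q` is the maximum of `0` and of the largest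
`d` for which some monotone path in the parameter square stays in the set where
`P x + R y ≥ d`, for `(P, R)` equal to `(P, -Q)` and to `(-P, Q)` (`flippedFrechet_eq`). Let `a` and
`b` be the vertex sequences of `P` and `R`.

Suppose that initial segments of both sequences, with maxima `A` and `B`, have been scanned. It
costs nothing to wait on each curve at its record: the next vertex `a (i + 1)` can be passed at
height `a (i + 1) + B`, and `b (j + 1)` at height `b (j + 1) + A`. If both values are less than `d`,
then no traversal of height `d` gets beyond these two vertices (`unblocked_of_traversal`). So the
greedy scan, which always makes the step of greater value, has a least step value that bounds the
height of every traversal. Conversely, a scan with all step values at least `d` yields a path of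
height `d` from the start to the first maxima of `a` and `b`, from where each curve can be followed
to its end while the other one waits at its maximum (`Frontier.exists_isAnchor`). Scanning the
reversed curves gives a path from the last maxima to the end, and the two paths can be joined
(`exists_traversal_of_frontier`). Hence the largest `d` is the minimum of the values of the forward
and of the backward scan.

A scan advances a position in one of the sequences at every step, so it takes `O(n)` primitive
operations. The program `algorithm` makes four scans; its correctness and running time are proved
by means of weakest preconditions of loop-free programs and a rule for loops with loop-free bodies
(`haltsIn_of_wp`, `haltsIn_loop`).
-/

namespace FlippedFrechet

/-! ### Frontier paths of two sequences -/

/-- `Frontier a b d i j`: starting from the first entries, the scanned initial segments of `a` and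
`b` can be extended one entry at a time up to the indices `i` and `j`, such that each newly scanned
entry of one sequence plus the maximum of the entries of the other one scanned so far is at
least `d`. -/
inductive Frontier (a b : ℕ → ℝ) (d : ℝ) : ℕ → ℕ → Prop
  | start : d ≤ a 0 + b 0 → Frontier a b d 0 0
  | left {i j : ℕ} : Frontier a b d i j → d ≤ a (i + 1) + partialSups b j →
      Frontier a b d (i + 1) j
  | right {i j : ℕ} : Frontier a b d i j → d ≤ b (j + 1) + partialSups a i →
      Frontier a b d i (j + 1)

theorem Frontier.anti {a b : ℕ → ℝ} {d e : ℝ} {i j : ℕ} (h : Frontier a b d i j) (hed : e ≤ d) :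
    Frontier a b e i j := by
  induction h with
  | start h => exact .start (hed.trans h)
  | left _ h ih => exact .left ih (hed.trans h)
  | right _ h ih => exact .right ih (hed.trans h)

/-- At no pair of scanned initial segments of `a` and `b`, both of length at most `n`, do all
possible extensions by one entry have a value less than `d`. -/
structure Unblocked (a b : ℕ → ℝ) (n : ℕ) (d : ℝ) : Prop where
  start : d ≤ a 0 + b 0
  left : ∀ i, i + 1 < n → d ≤ a (i + 1) + partialSups b (n - 1)
  right : ∀ j, j + 1 < n → d ≤ b (j + 1) + partialSups a (n - 1)
  both : ∀ i j, i + 1 < n → j + 1 < n →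
    d ≤ max (a (i + 1) + partialSups b j) (b (j + 1) + partialSups a i)

/-- The property of the value of a greedy scan of `a` and `b`, both of length `n`, that matters:
it is attained by a frontier path, and it is at least every value at which no extension is
blocked. -/
structure IsScanValue (a b : ℕ → ℝ) (n : ℕ) (v : ℝ) : Prop where
  frontier : Frontier a b v (n - 1) (n - 1)
  le : ∀ d, Unblocked a b n d → d ≤ v

/-! ### Vertices of polygonal curves -/

/-- The vertices of a polygonal curve, indexed from `0`. -/
def vertices (P : ℝ → ℝ) (i : ℕ) : ℝ := P ((i : ℝ) + 1)

/-- The curve of length `n` traversed backwards. -/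
def reversed (n : ℕ) (P : ℝ → ℝ) (x : ℝ) : ℝ := P ((n : ℝ) + 1 - x)

theorem vertices_reversed {n i : ℕ} (P : ℝ → ℝ) (hi : i < n) :
    vertices (reversed n P) i = vertices P (n - 1 - i) := by
  obtain ⟨k, rfl⟩ := Nat.exists_eq_add_of_lt hi
  have : i + k + 1 - 1 - i = k := by omega
  rw [this]
  simp only [vertices, reversed]
  congr 1
  push_cast
  ring

theorem isPolygonalCurve_neg {n : ℕ} {P : ℝ → ℝ} (hP : IsPolygonalCurve n P) :
    IsPolygonalCurve n (fun x => -P x) := by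
  refine ⟨hP.1.neg, fun i h1 hi l hl => ?_⟩
  simp only [hP.2 i h1 hi l hl, smul_eq_mul]
  ring

theorem isPolygonalCurve_reversed {n : ℕ} {P : ℝ → ℝ} (hP : IsPolygonalCurve n P) :
    IsPolygonalCurve n (reversed n P) := by
  refine ⟨hP.1.comp (by fun_prop) ?_, fun i h1 hi l hl => ?_⟩
  · rintro x ⟨hx1, hx2⟩
    constructor <;> linarith
  · have h := hP.2 (n - i) (by omega) (by omega) (1 - l) ⟨by linarith [hl.2], by linarith [hl.1]⟩
    rw [Nat.cast_sub hi.le] at h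
    have e1 : (n : ℝ) + 1 - (i + l) = n - i + (1 - l) := by ring
    have e2 : (n : ℝ) + 1 - i = n - i + 1 := by ring
    have e3 : (n : ℝ) + 1 - (i + 1) = n - i := by ring
    simp only [reversed, e1, e2, e3, h, smul_eq_mul]
    ring

/-- A polygonal curve stays in every convex set that contains the vertices of a stretch of it. -/
theorem mem_of_convex {n : ℕ} {P : ℝ → ℝ} (hP : IsPolygonalCurve n P) {S : Set ℝ}
    (hS : Convex ℝ S) {k i : ℕ} (hi : i < n) (hv : ∀ m, k ≤ m → m ≤ i → vertices P m ∈ S)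
    {x : ℝ} (hx : x ∈ Icc ((k : ℝ) + 1) ((i : ℝ) + 1)) : P x ∈ S := by
  have hki : k ≤ i := by
    have := hx.1.trans hx.2
    exact_mod_cast (by linarith : (k : ℝ) ≤ i)
  rcases hx.2.eq_or_lt with rfl | hlt
  · exact hv i hki le_rfl
  · have hk0 : (0 : ℝ) ≤ k := Nat.cast_nonneg k
    have h0 : 0 ≤ x - 1 := by linarith [hx.1]
    set m := ⌊x - 1⌋₊ with hm
    have hm1 : (m : ℝ) ≤ x - 1 := Nat.floor_le h0
    have hm2 : x - 1 < m + 1 := Nat.lt_floor_add_one _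
    have hkm : k ≤ m := Nat.le_floor (by linarith [hx.1])
    have hmi : m < i := by exact_mod_cast (by linarith : (m : ℝ) < i)
    have h := hP.2 (m + 1) (by omega) (by omega) (x - 1 - m) ⟨by linarith, by linarith⟩
    have e : ((m + 1 : ℕ) : ℝ) + (x - 1 - m) = x := by push_cast; ring
    rw [e] at h
    rw [h]
    have a1 : P ((m + 1 : ℕ) : ℝ) ∈ S := by
      simpa [vertices] using hv m hkm hmi.le
    have a2 : P (((m + 1 : ℕ) : ℝ) + 1) ∈ S := hv (m + 1) (by omega) hmi
    exact hS a1 a2 (by linarith) (by linarith) (by ring)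

theorem le_partialSups_vertices {n : ℕ} {P : ℝ → ℝ} (hP : IsPolygonalCurve n P) {i : ℕ}
    (hi : i < n) {x : ℝ} (hx : x ∈ Icc (1 : ℝ) ((i : ℝ) + 1)) :
    P x ≤ partialSups (vertices P) i :=
  mem_of_convex hP (convex_Iic (partialSups (vertices P) i)) (k := 0) hi
    (fun _ _ hm => le_partialSups_of_le (vertices P) hm) (by simpa using hx)

/-! ### Traversals keep the scan unblocked -/

theorem exists_mem_eq {n : ℕ} {f : ℝ → ℝ} (hf : IsTraversal n f) {i : ℕ} (hi : i < n) :
    ∃ t ∈ Icc (0 : ℝ) 1, f t = (i : ℝ) + 1 := by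
  have h : (i : ℝ) + 1 ∈ f '' Icc 0 1 := by
    rw [hf.2.2]
    exact ⟨by linarith [(Nat.cast_nonneg i : (0 : ℝ) ≤ i)], by exact_mod_cast hi⟩
  exact h

theorem apply_mem {n : ℕ} {f : ℝ → ℝ} (hf : IsTraversal n f) {t : ℝ} (ht : t ∈ Icc (0 : ℝ) 1) :
    f t ∈ Icc (1 : ℝ) n := hf.2.2 ▸ mem_image_of_mem f ht

theorem isTraversal_reversed {n : ℕ} {f : ℝ → ℝ} (hf : IsTraversal n f) :
    IsTraversal n (fun t => (n : ℝ) + 1 - f (1 - t)) := by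
  have hm : MapsTo (fun t : ℝ => 1 - t) (Icc 0 1) (Icc 0 1) := fun t ht =>
    ⟨by linarith [ht.2], by linarith [ht.1]⟩
  refine ⟨continuousOn_const.sub (hf.1.comp (by fun_prop) hm), fun s hs t ht hst => ?_, ?_⟩
  · have := hf.2.1 (hm ht) (hm hs) (by linarith : 1 - t ≤ 1 - s)
    simp only
    linarith
  · apply Subset.antisymm
    · rintro _ ⟨t, ht, rfl⟩
      have := apply_mem hf (hm ht)
      constructor <;> simp only <;> linarith [this.1, this.2]
    · rintro y ⟨hy1, hy2⟩
      have : (n : ℝ) + 1 - y ∈ f '' Icc 0 1 := by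
        rw [hf.2.2]
        constructor <;> linarith
      obtain ⟨t, ht, hft⟩ := this
      refine ⟨1 - t, hm ht, ?_⟩
      simp [hft]

theorem le_left_of_traversal {n : ℕ} {P R f g : ℝ → ℝ} {d : ℝ}
    (hR : IsPolygonalCurve n R) (hf : IsTraversal n f) (hg : IsTraversal n g)
    (h : ∀ t ∈ Icc (0 : ℝ) 1, d ≤ P (f t) + R (g t)) (i : ℕ) (hi : i + 1 < n) :
    d ≤ vertices P (i + 1) + partialSups (vertices R) (n - 1) := by
  obtain ⟨t, ht, hft⟩ := exists_mem_eq hf hi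
  have h1 := h t ht
  rw [hft] at h1
  have hgt := apply_mem hg ht
  refine h1.trans (add_le_add le_rfl (le_partialSups_vertices hR (by omega) ⟨hgt.1, ?_⟩))
  refine hgt.2.trans ?_
  exact_mod_cast (by omega : n ≤ n - 1 + 1)

/-- If the vertices `i + 1` of `P` and `j + 1` of `R` both lie below the preceding maxima, then the
traversal that reaches its vertex first does so while the other curve is below its maximum over
the vertices `0, …, j`; hence one of the two extensions has value at least `d`. -/
theorem le_left_of_traversal_of_le {n : ℕ} {P R f g : ℝ → ℝ} {d : ℝ}
    (hR : IsPolygonalCurve n R) (hg : IsTraversal n g)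
    (h : ∀ t ∈ Icc (0 : ℝ) 1, d ≤ P (f t) + R (g t)) {i j : ℕ} (hj : j + 1 < n)
    (hRj : vertices R (j + 1) ≤ partialSups (vertices R) j)
    {s t : ℝ} (hs : s ∈ Icc (0 : ℝ) 1) (ht : t ∈ Icc (0 : ℝ) 1) (hst : s ≤ t)
    (hfs : f s = ((i + 1 : ℕ) : ℝ) + 1) (hgt : g t = ((j + 1 : ℕ) : ℝ) + 1) :
    d ≤ vertices P (i + 1) + partialSups (vertices R) j := by
  have h1 := h s hs
  rw [hfs] at h1
  refine h1.trans (add_le_add le_rfl ?_)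
  have h2 := le_partialSups_vertices hR hj ⟨(apply_mem hg hs).1, hgt ▸ hg.2.1 hs ht hst⟩
  rwa [partialSups_add_one, sup_eq_left.2 hRj] at h2

/-- Every common lower bound of the height `P (f t) + R (g t)` along traversals is an unblocked
value of the vertex sequences. -/
theorem unblocked_of_traversal {n : ℕ} (hn : 1 ≤ n) {P R f g : ℝ → ℝ} {d : ℝ}
    (hP : IsPolygonalCurve n P) (hR : IsPolygonalCurve n R)
    (hf : IsTraversal n f) (hg : IsTraversal n g)
    (h : ∀ t ∈ Icc (0 : ℝ) 1, d ≤ P (f t) + R (g t)) :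
    Unblocked (vertices P) (vertices R) n d := by
  have h' : ∀ t ∈ Icc (0 : ℝ) 1, d ≤ R (g t) + P (f t) := fun t ht => by
    rw [add_comm]; exact h t ht
  have h0 : d ≤ vertices P 0 + vertices R 0 := by
    have := h 0 (by simp)
    rw [hf.apply_zero hn, hg.apply_zero hn] at this
    simpa [vertices] using this
  refine ⟨h0, le_left_of_traversal hR hf hg h, le_left_of_traversal hP hg hf h',
    fun i j hi hj => ?_⟩
  by_contra! hlt
  obtain ⟨hl, hr⟩ := max_lt_iff.1 hlt
  have hA : vertices P 0 ≤ partialSups (vertices P) i := le_partialSups_of_le _ (Nat.zero_le i)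
  have hB : vertices R 0 ≤ partialSups (vertices R) j := le_partialSups_of_le _ (Nat.zero_le j)
  obtain ⟨s, hs, hfs⟩ := exists_mem_eq hf hi
  obtain ⟨t, ht, hgt⟩ := exists_mem_eq hg hj
  rcases le_total s t with hst | hst
  · exact absurd (le_left_of_traversal_of_le hR hg h hj (by linarith) hs ht hst hfs hgt)
      hl.not_ge
  · exact absurd (le_left_of_traversal_of_le hP hf h' hi (by linarith) ht hs hst hgt hfs)
      hr.not_ge

/-! ### Monotone paths above a given height -/

/-- Some monotone path in the parameter plane leads from `(x, y)` to `(x', y')` and keeps the height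
`P + R` at least `d`. -/
def Reach (P R : ℝ → ℝ) (d x y x' y' : ℝ) : Prop :=
  ∃ f g : ℝ → ℝ, (Continuous f ∧ Monotone f ∧ f 0 = x ∧ f 1 = x') ∧
    (Continuous g ∧ Monotone g ∧ g 0 = y ∧ g 1 = y') ∧
    ∀ t ∈ Icc (0 : ℝ) 1, d ≤ P (f t) + R (g t)

theorem Reach.swap {P R : ℝ → ℝ} {d x y x' y' : ℝ} (h : Reach P R d x y x' y') :
    Reach R P d y x y' x' := by
  obtain ⟨f, g, hf, hg, hd⟩ := h
  exact ⟨g, f, hg, hf, fun t ht => by rw [add_comm]; exact hd t ht⟩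

/-- Two monotone functions on `[0, 1]` are run one after the other by adding them, each with its
argument clamped to `[0, 1]`. -/
theorem exists_concat {f₁ f₂ : ℝ → ℝ} (h₁ : Continuous f₁ ∧ Monotone f₁)
    (h₂ : Continuous f₂ ∧ Monotone f₂) (h : f₁ 1 = f₂ 0) :
    ∃ f : ℝ → ℝ, Continuous f ∧ Monotone f ∧ (∀ t ≤ 1 / 2, f t = f₁ (2 * t)) ∧
      ∀ t, 1 / 2 ≤ t → f t = f₂ (2 * t - 1) := by
  obtain ⟨c₁, m₁⟩ := h₁
  obtain ⟨c₂, m₂⟩ := h₂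
  refine ⟨fun t => f₁ (min (2 * t) 1) + (f₂ (max (2 * t - 1) 0) - f₂ 0), by fun_prop, ?_, ?_, ?_⟩
  · intro s t hst
    have e₁ : min (2 * s) 1 ≤ min (2 * t) 1 := min_le_min (by linarith) le_rfl
    have e₂ : max (2 * s - 1) 0 ≤ max (2 * t - 1) 0 := max_le_max (by linarith) le_rfl
    have := m₁ e₁
    have := m₂ e₂
    simp only
    linarith
  · intro t ht
    simp only
    rw [min_eq_left (by linarith), max_eq_right (by linarith)]
    ring
  · intro t ht
    simp only
    rw [min_eq_right (by linarith), max_eq_left (by linarith), h]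
    ring

theorem Reach.trans {P R : ℝ → ℝ} {d x y x' y' x'' y'' : ℝ} (h₁ : Reach P R d x y x' y')
    (h₂ : Reach P R d x' y' x'' y'') : Reach P R d x y x'' y'' := by
  obtain ⟨f₁, g₁, ⟨cf₁, mf₁, hf₁, hf₁'⟩, ⟨cg₁, mg₁, hg₁, hg₁'⟩, hd₁⟩ := h₁
  obtain ⟨f₂, g₂, ⟨cf₂, mf₂, hf₂, hf₂'⟩, ⟨cg₂, mg₂, hg₂, hg₂'⟩, hd₂⟩ := h₂
  obtain ⟨f, cf, mf, fl, fr⟩ := exists_concat ⟨cf₁, mf₁⟩ ⟨cf₂, mf₂⟩ (by rw [hf₁', hf₂])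
  obtain ⟨g, cg, mg, gl, gr⟩ := exists_concat ⟨cg₁, mg₁⟩ ⟨cg₂, mg₂⟩ (by rw [hg₁', hg₂])
  have e : (2 : ℝ) * 1 - 1 = 1 := by norm_num
  refine ⟨f, g, ⟨cf, mf, ?_, ?_⟩, ⟨cg, mg, ?_, ?_⟩, fun t ht => ?_⟩
  · rw [fl 0 (by norm_num), mul_zero, hf₁]
  · rw [fr 1 (by norm_num), e, hf₂']
  · rw [gl 0 (by norm_num), mul_zero, hg₁]
  · rw [gr 1 (by norm_num), e, hg₂']
  · rcases le_total t (1 / 2) with h | h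
    · rw [fl t h, gl t h]
      exact hd₁ _ ⟨by linarith [ht.1], by linarith⟩
    · rw [fr t h, gr t h]
      exact hd₂ _ ⟨by linarith, by linarith [ht.2]⟩

/-- A path along one coordinate; its height is controlled at the vertices. -/
theorem reach_left {n : ℕ} {P R : ℝ → ℝ} (hP : IsPolygonalCurve n P) {d y : ℝ} {k i : ℕ}
    (hki : k ≤ i) (hi : i < n) (h : ∀ m, k ≤ m → m ≤ i → d ≤ vertices P m + R y) :
    Reach P R d ((k : ℝ) + 1) y ((i : ℝ) + 1) y := by
  have hki' : (k : ℝ) ≤ i := by exact_mod_cast hki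
  refine ⟨fun t => (k : ℝ) + 1 + (i - k) * t, fun _ => y, ⟨by fun_prop, fun s t hst => ?_, by simp,
    by ring⟩, ⟨continuous_const, monotone_const, rfl, rfl⟩, fun t ht => ?_⟩
  · have := mul_le_mul_of_nonneg_left hst (sub_nonneg.2 hki')
    simp only
    linarith
  · have hmem : P ((k : ℝ) + 1 + (i - k) * t) ∈ Ici (d - R y) := by
      refine mem_of_convex hP (convex_Ici _) (k := k) hi (fun m h1 h2 => ?_) ⟨?_, ?_⟩
      · exact sub_le_iff_le_add.2 (h m h1 h2)
      · nlinarith [ht.1]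
      · nlinarith [ht.2]
    exact sub_le_iff_le_add.1 hmem

theorem Reach.of_reversed {n : ℕ} {P R : ℝ → ℝ} {d x y x' y' : ℝ}
    (h : Reach (reversed n P) (reversed n R) d x y x' y') :
    Reach P R d (n + 1 - x') (n + 1 - y') (n + 1 - x) (n + 1 - y) := by
  obtain ⟨f, g, ⟨cf, mf, rfl, rfl⟩, ⟨cg, mg, rfl, rfl⟩, hd⟩ := h
  refine ⟨fun t => n + 1 - f (1 - t), fun t => n + 1 - g (1 - t),
    ⟨by fun_prop, fun s t hst => ?_, by simp, by simp⟩,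
    ⟨by fun_prop, fun s t hst => ?_, by simp, by simp⟩,
    fun t ht => hd (1 - t) ⟨by linarith [ht.2], by linarith [ht.1]⟩⟩
  · exact sub_le_sub_left (mf (by linarith)) _
  · exact sub_le_sub_left (mg (by linarith)) _

theorem Reach.exists_traversal {n : ℕ} {P R : ℝ → ℝ} {d : ℝ} (h : Reach P R d 1 1 n n) :
    ∃ f g : ℝ → ℝ, IsTraversal n f ∧ IsTraversal n g ∧
      ∀ t ∈ Icc (0 : ℝ) 1, d ≤ P (f t) + R (g t) := by
  have aux : ∀ f : ℝ → ℝ, Continuous f ∧ Monotone f ∧ f 0 = 1 ∧ f 1 = n → IsTraversal n f := by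
    rintro f ⟨cf, mf, h0, h1⟩
    refine ⟨cf.continuousOn, mf.monotoneOn _, Subset.antisymm ?_ ?_⟩
    · rintro _ ⟨t, ht, rfl⟩
      exact ⟨h0 ▸ mf ht.1, h1 ▸ mf ht.2⟩
    · have := intermediate_value_Icc (zero_le_one (α := ℝ)) cf.continuousOn
      rwa [h0, h1] at this
  obtain ⟨f, g, hf, hg, hd⟩ := h
  exact ⟨f, g, aux f hf, aux g hg, hd⟩

/-! ### From frontier paths to traversals -/

/-- `k` is the first index at which `a` attains its maximum over the indices `0, …, i`. -/
structure IsFirstArgmax (a : ℕ → ℝ) (i k : ℕ) : Prop where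
  le : k ≤ i
  apply_le : ∀ m ≤ i, a m ≤ a k
  apply_lt : ∀ m < k, a m < a k

theorem IsFirstArgmax.partialSups_eq {a : ℕ → ℝ} {i k : ℕ} (h : IsFirstArgmax a i k) :
    partialSups a i = a k :=
  le_antisymm (partialSups_le a i _ h.apply_le) (le_partialSups_of_le a h.le)

/-- The scan up to `(i, j)` is realised by a path to the pair `(k, l)` of the positions of the first
maxima, from where each of the curves can be followed alone up to the end of its scanned part. -/
structure IsAnchor (P R : ℝ → ℝ) (d : ℝ) (i j k l : ℕ) : Prop where
  left : IsFirstArgmax (vertices P) i k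
  right : IsFirstArgmax (vertices R) j l
  reach : Reach P R d 1 1 ((k : ℝ) + 1) ((l : ℝ) + 1)
  le_left : ∀ m, k ≤ m → m ≤ i → d ≤ vertices P m + vertices R l
  le_right : ∀ m, l ≤ m → m ≤ j → d ≤ vertices R m + vertices P k

theorem IsAnchor.swap {P R : ℝ → ℝ} {d : ℝ} {i j k l : ℕ} (h : IsAnchor P R d i j k l) :
    IsAnchor R P d j i l k :=
  ⟨h.right, h.left, h.reach.swap, h.le_right, h.le_left⟩

theorem IsAnchor.step {n : ℕ} {P R : ℝ → ℝ} {d : ℝ} {i j k l : ℕ} (hP : IsPolygonalCurve n P)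
    (h : IsAnchor P R d i j k l) (hi : i + 1 < n)
    (hd : d ≤ vertices P (i + 1) + partialSups (vertices R) j) :
    ∃ k', IsAnchor P R d (i + 1) j k' l := by
  rw [h.right.partialSups_eq] at hd
  have hle : ∀ m, k ≤ m → m ≤ i + 1 → d ≤ vertices P m + vertices R l := fun m h1 h2 => by
    rcases Nat.le_succ_iff.1 h2 with h2 | rfl
    · exact h.le_left m h1 h2
    · exact hd
  rcases le_or_gt (vertices P (i + 1)) (vertices P k) with hk | hk
  · refine ⟨k, ⟨h.left.le.trans (Nat.le_succ i), fun m hm => ?_, h.left.apply_lt⟩, h.right, h.reach,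
      hle, h.le_right⟩
    rcases Nat.le_succ_iff.1 hm with hm | rfl
    · exact h.left.apply_le m hm
    · exact hk
  · have hlt : ∀ m < i + 1, vertices P m < vertices P (i + 1) := fun m hm =>
      (h.left.apply_le m (Nat.lt_succ_iff.1 hm)).trans_lt hk
    refine ⟨i + 1, ⟨le_rfl, fun m hm => ?_, hlt⟩, h.right,
      h.reach.trans (reach_left hP (h.left.le.trans (Nat.le_succ i)) hi hle),
      fun m h1 h2 => hle m (h.left.le.trans (Nat.le_of_succ_le h1)) h2,
      fun m h1 h2 => (h.le_right m h1 h2).trans (add_le_add le_rfl hk.le)⟩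
    rcases hm.lt_or_eq with hm | rfl
    · exact (hlt m hm).le
    · exact le_rfl

theorem Frontier.exists_isAnchor {n : ℕ} {P R : ℝ → ℝ} {d : ℝ} {i j : ℕ}
    (hP : IsPolygonalCurve n P) (hR : IsPolygonalCurve n R)
    (h : Frontier (vertices P) (vertices R) d i j) (hi : i < n) (hj : j < n) :
    ∃ k l, IsAnchor P R d i j k l := by
  induction h with
  | start h0 =>
    have hz : ∀ a : ℕ → ℝ, IsFirstArgmax a 0 0 := fun a =>
      ⟨le_rfl, fun m hm => by rw [Nat.le_zero.1 hm], fun m hm => absurd hm m.not_lt_zero⟩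
    refine ⟨0, 0, hz _, hz _, ?_, fun m _ hm => ?_, fun m _ hm => ?_⟩
    · have := reach_left (R := R) (y := ((0 : ℕ) : ℝ) + 1) hP (le_refl 0) hi (d := d)
        fun m _ hm => by rw [Nat.le_zero.1 hm]; exact h0
      simpa using this
    · rwa [Nat.le_zero.1 hm]
    · rwa [Nat.le_zero.1 hm, add_comm]
  | left _ hd ih =>
    obtain ⟨k, l, h⟩ := ih (by omega) hj
    obtain ⟨k', h'⟩ := h.step hP hi hd
    exact ⟨k', l, h'⟩
  | right _ hd ih =>
    obtain ⟨k, l, h⟩ := ih hi (by omega)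
    obtain ⟨l', h'⟩ := h.swap.step hR hj hd
    exact ⟨k, l', h'.swap⟩

/-- The first maximum of the vertices comes no later than the first one met in the reversed
curve. -/
theorem IsFirstArgmax.le_of_reversed {n : ℕ} {P : ℝ → ℝ} {k k' : ℕ} (hn : 1 ≤ n)
    (h : IsFirstArgmax (vertices P) (n - 1) k)
    (h' : IsFirstArgmax (vertices (reversed n P)) (n - 1) k') :
    k ≤ n - 1 - k' ∧ vertices P (n - 1 - k') = vertices P k := by
  have hk := h.le
  have hk' := h'.le
  have h1 : vertices P k ≤ vertices P (n - 1 - k') := by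
    have := h'.apply_le (n - 1 - k) (by omega)
    rwa [vertices_reversed P (by omega), vertices_reversed P (by omega),
      show n - 1 - (n - 1 - k) = k by omega] at this
  refine ⟨?_, le_antisymm (h.apply_le _ (Nat.sub_le _ _)) h1⟩
  by_contra! hlt
  exact absurd (h.apply_lt _ hlt) h1.not_gt

/-- Frontier paths of the two curves and of their reversals yield a traversal of height at
least `d`: both lead to the maxima of the vertices, where they are joined. -/
theorem exists_traversal_of_frontier {n : ℕ} (hn : 1 ≤ n) {P R : ℝ → ℝ} {d : ℝ}
    (hP : IsPolygonalCurve n P) (hR : IsPolygonalCurve n R)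
    (h : Frontier (vertices P) (vertices R) d (n - 1) (n - 1))
    (h' : Frontier (vertices (reversed n P)) (vertices (reversed n R)) d (n - 1) (n - 1)) :
    ∃ f g : ℝ → ℝ, IsTraversal n f ∧ IsTraversal n g ∧
      ∀ t ∈ Icc (0 : ℝ) 1, d ≤ P (f t) + R (g t) := by
  obtain ⟨k, l, ha⟩ := h.exists_isAnchor hP hR (by omega) (by omega)
  obtain ⟨k', l', ha'⟩ := h'.exists_isAnchor (isPolygonalCurve_reversed hP)
    (isPolygonalCurve_reversed hR) (by omega) (by omega)
  obtain ⟨hk, ek⟩ := ha.left.le_of_reversed hn ha'.left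
  obtain ⟨hl, -⟩ := ha.right.le_of_reversed hn ha'.right
  have hcast : ∀ m ≤ n - 1, ((n - 1 - m : ℕ) : ℝ) + 1 = n + 1 - ((m : ℝ) + 1) := fun m hm => by
    rw [Nat.cast_sub hm, Nat.cast_sub hn]
    push_cast
    ring
  have r₁ : Reach P R d ((k : ℝ) + 1) ((l : ℝ) + 1) ((n - 1 - k' : ℕ) + 1) ((l : ℝ) + 1) :=
    reach_left hP hk (by omega) fun m h1 h2 => ha.le_left m h1 (by omega)
  have r₂ : Reach P R d ((n - 1 - k' : ℕ) + 1) ((l : ℝ) + 1) ((n - 1 - k' : ℕ) + 1)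
      ((n - 1 - l' : ℕ) + 1) :=
    (reach_left hR hl (by omega) fun m h1 h2 => by
      have := ha.le_right m h1 (by omega)
      rwa [← ek] at this).swap
  have r₃ := ha'.reach.of_reversed
  rw [← hcast k' ha'.left.le, ← hcast l' ha'.right.le, add_sub_cancel_right] at r₃
  exact (((ha.reach.trans r₁).trans r₂).trans r₃).exists_traversal

/-! ### The flipped Fréchet measure in terms of scan values -/

theorem le_flippedFrechet {n : ℕ} (hn : 1 ≤ n) {P Q f g : ℝ → ℝ} {d : ℝ}
    (hP : IsPolygonalCurve n P) (hQ : IsPolygonalCurve n Q)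
    (hf : IsTraversal n f) (hg : IsTraversal n g)
    (h : ∀ t ∈ Icc (0 : ℝ) 1, d ≤ ‖P (f t) - Q (g t)‖) : d ≤ flippedFrechet n n P Q := by
  have hPc := hP.1.comp hf.1 (fun t ht => apply_mem hf ht)
  have hQc := hQ.1.comp hg.1 (fun t ht => apply_mem hg ht)
  obtain ⟨e, he⟩ := (isCompact_Icc.image_of_continuousOn (hPc.sub hQc).norm).exists_isLeast
    (Set.Nonempty.image _ ⟨0, by simp⟩)
  refine le_trans ?_ ((isLUB_flippedFrechet hn hn hP hQ).1 ⟨f, g, hf, hg, he⟩)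
  obtain ⟨t, ht, rfl⟩ := he.1
  exact h t ht

theorem le_scanValue {n : ℕ} (hn : 1 ≤ n) {P R f g : ℝ → ℝ} {d v w : ℝ}
    (hP : IsPolygonalCurve n P) (hR : IsPolygonalCurve n R)
    (hv : IsScanValue (vertices P) (vertices R) n v)
    (hw : IsScanValue (vertices (reversed n P)) (vertices (reversed n R)) n w)
    (hf : IsTraversal n f) (hg : IsTraversal n g)
    (h : ∀ t ∈ Icc (0 : ℝ) 1, d ≤ P (f t) + R (g t)) : d ≤ min v w := by
  refine le_min (hv.le d (unblocked_of_traversal hn hP hR hf hg h)) (hw.le d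
    (unblocked_of_traversal hn (isPolygonalCurve_reversed hP) (isPolygonalCurve_reversed hR)
      (isTraversal_reversed hf) (isTraversal_reversed hg) fun t ht => ?_))
  simpa [reversed] using h (1 - t) ⟨by linarith [ht.2], by linarith [ht.1]⟩

theorem flippedFrechet_eq {n : ℕ} (hn : 1 ≤ n) {P Q : ℝ → ℝ} {v w v' w' : ℝ}
    (hP : IsPolygonalCurve n P) (hQ : IsPolygonalCurve n Q)
    (hv : IsScanValue (vertices P) (vertices fun x => -Q x) n v)
    (hw : IsScanValue (vertices (reversed n P)) (vertices (reversed n fun x => -Q x)) n w)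
    (hv' : IsScanValue (vertices fun x => -P x) (vertices Q) n v')
    (hw' : IsScanValue (vertices (reversed n fun x => -P x)) (vertices (reversed n Q)) n w') :
    flippedFrechet n n P Q = max 0 (max (min v w) (min v' w')) := by
  have hlub := isLUB_flippedFrechet hn hn hP hQ
  have hPn := isPolygonalCurve_neg hP
  have hQn := isPolygonalCurve_neg hQ
  apply le_antisymm
  · refine hlub.2 ?_
    rintro d ⟨f, g, hf, hg, hd⟩
    have hdt : ∀ t ∈ Icc (0 : ℝ) 1, d ≤ |P (f t) - Q (g t)| := fun t ht =>
      hd.2 (mem_image_of_mem _ ht)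
    rcases le_or_gt d 0 with h0 | h0
    · exact h0.trans (le_max_left _ _)
    refine le_max_of_le_right ?_
    -- The difference never vanishes, so by continuity it has a constant sign.
    have hc : ContinuousOn (fun t => P (f t) - Q (g t)) (Icc 0 1) :=
      (hP.1.comp hf.1 fun t ht => apply_mem hf ht).sub
        (hQ.1.comp hg.1 fun t ht => apply_mem hg ht)
    have hne : ∀ t ∈ Icc (0 : ℝ) 1, P (f t) - Q (g t) ≠ 0 := fun t ht h => by
      have := hdt t ht
      rw [h, abs_zero] at this
      exact absurd this h0.not_ge
    have hsign : (∀ t ∈ Icc (0 : ℝ) 1, 0 < P (f t) - Q (g t)) ∨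
        ∀ t ∈ Icc (0 : ℝ) 1, P (f t) - Q (g t) < 0 := by
      by_contra! hcon
      obtain ⟨⟨s, hs, hs0⟩, t, ht, ht0⟩ := hcon
      obtain ⟨r, hr, hr0⟩ := isPreconnected_Icc.intermediate_value hs ht hc ⟨hs0, ht0⟩
      exact hne r hr hr0
    rcases hsign with hpos | hneg
    · refine le_max_of_le_left (le_scanValue hn hP hQn hv hw hf hg fun t ht => ?_)
      have := hdt t ht
      rw [abs_of_pos (hpos t ht)] at this
      linarith
    · refine le_max_of_le_right (le_scanValue hn hPn hQ hv' hw' hf hg fun t ht => ?_)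
      have := hdt t ht
      rw [abs_of_neg (hneg t ht)] at this
      linarith
  · refine max_le ?_ (max_le ?_ ?_)
    · exact le_flippedFrechet hn hP hQ (isTraversal_affine hn) (isTraversal_affine hn)
        fun t _ => norm_nonneg _
    · obtain ⟨f, g, hf, hg, h⟩ := exists_traversal_of_frontier hn hP hQn
        (hv.frontier.anti (min_le_left v w)) (hw.frontier.anti (min_le_right v w))
      refine le_flippedFrechet hn hP hQ hf hg fun t ht => (h t ht).trans ?_
      rw [← sub_eq_add_neg]
      exact le_abs_self _
    · obtain ⟨f, g, hf, hg, h⟩ := exists_traversal_of_frontier hn hPn hQ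
        (hv'.frontier.anti (min_le_left v' w')) (hw'.frontier.anti (min_le_right v' w'))
      refine le_flippedFrechet hn hP hQ hf hg fun t ht => (h t ht).trans ?_
      rw [neg_add_eq_sub, ← neg_sub]
      exact neg_le_abs _

/-! ### Verifying real RAM programs -/

open RealRAM

/-- Weakest preconditions of loop-free programs. -/
def wp : Cmd → (State → Prop) → State → Prop
  | .skip, Q, s => Q s
  | .setNat a i e, Q, s => Q (s.setNat a (i.eval s) (e.eval s))
  | .setReal a i e, Q, s => Q (s.setReal a (i.eval s) (e.eval s))
  | .seq c₁ c₂, Q, s => wp c₁ (wp c₂ Q) s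
  | .ite b c₁ c₂, Q, s => (b.eval s → wp c₁ Q s) ∧ (¬ b.eval s → wp c₂ Q s)
  | .loop _ _, _, _ => False

/-- An upper bound for the running time of a loop-free program. -/
def maxCost : Cmd → ℕ
  | .skip => 1
  | .setNat _ i e => i.cost + e.cost + 1
  | .setReal _ i e => i.cost + e.cost + 1
  | .seq c₁ c₂ => maxCost c₁ + maxCost c₂
  | .ite b c₁ c₂ => b.cost + 1 + (maxCost c₁ + maxCost c₂)
  | .loop _ _ => 0

/-- Started in `s`, the program `c` halts within `K` steps in a state that satisfies `Q`. -/
def HaltsIn (c : Cmd) (s : State) (K : ℕ) (Q : State → Prop) : Prop :=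
  ∃ t s', Exec c s t s' ∧ t ≤ K ∧ Q s'

theorem haltsIn_of_wp {c : Cmd} {Q : State → Prop} {s : State} (h : wp c Q s) :
    HaltsIn c s (maxCost c) Q := by
  induction c generalizing Q s with
  | skip => exact ⟨_, _, .skip s, le_rfl, h⟩
  | setNat a i e => exact ⟨_, _, .setNat a i e s, le_rfl, h⟩
  | setReal a i e => exact ⟨_, _, .setReal a i e s, le_rfl, h⟩
  | seq c₁ c₂ ih₁ ih₂ =>
    obtain ⟨t₁, s₁, e₁, k₁, h₁⟩ := ih₁ h
    obtain ⟨t₂, s₂, e₂, k₂, h₂⟩ := ih₂ h₁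
    exact ⟨_, _, .seq e₁ e₂, Nat.add_le_add k₁ k₂, h₂⟩
  | ite b c₁ c₂ ih₁ ih₂ =>
    by_cases hb : b.eval s
    · obtain ⟨t, s', e, k, h'⟩ := ih₁ (h.1 hb)
      exact ⟨_, _, .iteTrue hb e, by simp only [maxCost]; omega, h'⟩
    · obtain ⟨t, s', e, k, h'⟩ := ih₂ (h.2 hb)
      exact ⟨_, _, .iteFalse hb e, by simp only [maxCost]; omega, h'⟩
  | loop b c => exact h.elim

theorem HaltsIn.seq {c₁ c₂ : Cmd} {s : State} {K₁ K₂ : ℕ} {Q₁ Q₂ : State → Prop}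
    (h₁ : HaltsIn c₁ s K₁ Q₁) (h₂ : ∀ s', Q₁ s' → HaltsIn c₂ s' K₂ Q₂) :
    HaltsIn (.seq c₁ c₂) s (K₁ + K₂) Q₂ := by
  obtain ⟨t₁, s₁, e₁, k₁, q₁⟩ := h₁
  obtain ⟨t₂, s₂, e₂, k₂, q₂⟩ := h₂ s₁ q₁
  exact ⟨_, _, .seq e₁ e₂, Nat.add_le_add k₁ k₂, q₂⟩

/-- The rule for loops with a loop-free body: `I` is an invariant, and `μ` bounds the number of
remaining iterations. -/
theorem haltsIn_loop {b : BExp} {c : Cmd} {I : State → Prop} {μ : State → ℕ}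
    (h : ∀ s, I s → b.eval s → wp c (fun s' => I s' ∧ μ s' + 1 ≤ μ s) s) (s : State) (hs : I s)
    {m : ℕ} (hm : μ s ≤ m) :
    HaltsIn (.loop b c) s ((b.cost + 1 + maxCost c) * m + (b.cost + 1))
      (fun s' => I s' ∧ ¬ b.eval s') := by
  induction m generalizing s with
  | zero =>
    by_cases hb : b.eval s
    · obtain ⟨-, s', -, -, -, h'⟩ := haltsIn_of_wp (h s hs hb)
      omega
    · exact ⟨_, _, .loopFalse hb, by simp, hs, hb⟩
  | succ m ih =>
    by_cases hb : b.eval s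
    · obtain ⟨t, s', e, k, hI, h'⟩ := haltsIn_of_wp (h s hs hb)
      obtain ⟨t', s'', e', k', q⟩ := ih s' hI (by omega)
      refine ⟨_, _, .loopTrue hb e e', ?_, q⟩
      rw [Nat.mul_succ]
      omega
    · exact ⟨_, _, .loopFalse hb, by omega, hs, hb⟩

/-! ### The scanning program -/

/-- The cell with index `i` of the natural-number array `1`: the current positions of a scan of two
sequences are kept in its cells `0` and `1`. -/
def pos (i : ℕ) : NExp := .get 1 (.const i)

/-- The cell with index `i` of the real array `3`: cells `0` and `1` hold the maxima of the scanned
parts of the two sequences, cell `2` the least value of a step so far, and cell `3` the newly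
scanned entry. -/
def reg (i : ℕ) : RExp := .get 3 (.const i)

/-- The length of the curves. -/
def len : NExp := .get 0 (.const 0)

/-- Scan the next entry of the sequence number `x`, which is read by means of `ρ`; the other sequence
has the number `y`. -/
def advance (ρ : NExp → RExp) (x y : ℕ) : Cmd :=
  .seq (.setNat 1 (.const x) (.add (pos x) (.const 1))) <|
  .seq (.setReal 3 (.const 3) (ρ (pos x))) <|
  .seq (.ite (.realLe (.add (reg 3) (reg y)) (reg 2))
    (.setReal 3 (.const 2) (.add (reg 3) (reg y))) .skip) <|
  .ite (.realLe (reg x) (reg 3)) (.setReal 3 (.const x) (reg 3)) .skip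

/-- One step of the greedy scan: of the two possible extensions, the one with the greater value is
made. -/
def scanStep (α β : NExp → RExp) : Cmd :=
  .ite (.natLe len (.add (pos 1) (.const 1))) (advance α 0 1) <|
  .ite (.natLe len (.add (pos 0) (.const 1))) (advance β 1 0) <|
  .ite (.realLe (.add (β (.add (pos 1) (.const 1))) (reg 0))
      (.add (α (.add (pos 0) (.const 1))) (reg 1)))
    (advance α 0 1) (advance β 1 0)

/-- A scan is unfinished as long as one of the sequences has an unread entry. -/
def scanUnfinished : BExp :=
  .neg (.conj (.natLe len (.add (pos 0) (.const 1))) (.natLe len (.add (pos 1) (.const 1))))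

def scanInit (α β : NExp → RExp) : Cmd :=
  .seq (.setNat 1 (.const 0) (.const 0)) <|
  .seq (.setNat 1 (.const 1) (.const 0)) <|
  .seq (.setReal 3 (.const 0) (α (.const 0))) <|
  .seq (.setReal 3 (.const 1) (β (.const 0))) <|
  .setReal 3 (.const 2) (.add (reg 0) (reg 1))

/-- The greedy scan of the sequences read by `α` and `β`, whose value is stored in the cell with index
`k` of the real array `4`. -/
def scan (α β : NExp → RExp) (k : ℕ) : Cmd :=
  .seq (scanInit α β) <| .seq (.loop scanUnfinished (scanStep α β)) <|
    .setReal 4 (.const k) (reg 2)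

/-- A bound for the running time of `scan` on curves of length `n`. -/
def scanTime (α β : NExp → RExp) (n : ℕ) : ℕ :=
  maxCost (scanInit α β) + ((scanUnfinished.cost + 1 + maxCost (scanStep α β)) * (2 * n) +
    (scanUnfinished.cost + 1) + maxCost (.setReal 4 (.const 0) (reg 2)))

/-- The memory holds the input: two curves of length `n` with vertices `p` and `q`. -/
structure HoldsInput (n : ℕ) (p q : ℕ → ℝ) (s : State) : Prop where
  len : s.nat 0 0 = n
  fst : s.real 0 = p
  snd : s.real 1 = q

/-- In every memory state that holds the input, the expression `ρ e` evaluates to the entry of `a`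
with index `e`. -/
def Reads (n : ℕ) (p q : ℕ → ℝ) (ρ : NExp → RExp) (a : ℕ → ℝ) : Prop :=
  ∀ s e, HoldsInput n p q s → e.eval s < n → (ρ e).eval s = a (e.eval s)

/-- The invariant of the scan; `r` is the content of the array of results. -/
structure ScanInv (n : ℕ) (p q a b r : ℕ → ℝ) (s : State) : Prop where
  input : HoldsInput n p q s
  result : s.real 4 = r
  lt_fst : s.nat 1 0 < n
  lt_snd : s.nat 1 1 < n
  max_fst : s.real 3 0 = partialSups a (s.nat 1 0)
  max_snd : s.real 3 1 = partialSups b (s.nat 1 1)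
  frontier : Frontier a b (s.real 3 2) (s.nat 1 0) (s.nat 1 1)
  le : ∀ d, Unblocked a b n d → d ≤ s.real 3 2

/-- The effect of `advance`, with `c` the newly scanned entry. -/
theorem wp_advance {n : ℕ} {p q a : ℕ → ℝ} {ρ : NExp → RExp} {s : State} {x y : ℕ} {c : ℝ}
    {Q : State → Prop} (hx : x < 2) (hy : y < 2) (hxy : x ≠ y) (hρ : Reads n p q ρ a)
    (hs : HoldsInput n p q s) (hi : s.nat 1 x + 1 < n) (hc : a (s.nat 1 x + 1) = c)
    (hQ : ∀ s', HoldsInput n p q s' → s'.real 4 = s.real 4 → s'.nat 1 x = s.nat 1 x + 1 →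
      s'.nat 1 y = s.nat 1 y → s'.real 3 x = max (s.real 3 x) c → s'.real 3 y = s.real 3 y →
      s'.real 3 2 = min (s.real 3 2) (c + s.real 3 y) → Q s') :
    wp (advance ρ x y) Q s := by
  obtain ⟨h1, h2, h3⟩ := hs
  have hr := hρ (s.setNat 1 x (s.nat 1 x + 1)) (pos x) ⟨by simpa [State.setNat] using h1,
    h2, h3⟩ (by simpa [State.setNat, pos, NExp.eval] using hi)
  simp only [State.setNat, pos, NExp.eval, Function.update_self, hc] at hr
  have x3 : x ≠ 3 := by omega
  have y3 : y ≠ 3 := by omega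
  have x2 : x ≠ 2 := by omega
  have y2 : y ≠ 2 := by omega
  simp only [advance, wp, State.setNat, State.setReal, NExp.eval, RExp.eval, BExp.eval, pos, reg,
    hr, Function.update_self, Function.update_of_ne, ne_eq, y3, x3, not_false_eq_true,
    Nat.reduceEqDiff, Function.update_idem]
  constructor <;> intro hM <;> constructor <;> intro hA <;> apply hQ <;>
  first
    | exact ⟨by simpa using h1, by simpa using h2, by simpa using h3⟩
    | simp_all [le_of_lt, Ne.symm]

/-- The number of entries not yet scanned, up to an additive constant. -/
def remaining (n : ℕ) (s : State) : ℕ := 2 * n - s.nat 1 0 - s.nat 1 1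

theorem ScanInv.wp_left {n : ℕ} {p q a b r : ℕ → ℝ} {ρ : NExp → RExp} {s : State}
    (h : ScanInv n p q a b r s) (hρ : Reads n p q ρ a) (hi : s.nat 1 0 + 1 < n)
    (hd : ∀ d, Unblocked a b n d → d ≤ a (s.nat 1 0 + 1) + partialSups b (s.nat 1 1)) :
    wp (advance ρ 0 1) (fun s' => ScanInv n p q a b r s' ∧ remaining n s' + 1 ≤ remaining n s)
      s := by
  refine wp_advance (by omega) (by omega) (by omega) hρ h.input hi rfl
    fun s' k1 k2 k3 k4 k5 k6 k7 => ?_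
  have h1 := h.lt_fst
  have h2 := h.lt_snd
  refine ⟨⟨k1, k2.trans h.result, k3 ▸ hi, k4 ▸ h2, ?_, ?_, ?_, fun d hu => ?_⟩, ?_⟩
  · rw [k5, k3, partialSups_add_one, h.max_fst]
  · rw [k6, k4, h.max_snd]
  · rw [k3, k4, k7, h.max_snd]
    exact .left (h.frontier.anti (min_le_left _ _)) (min_le_right _ _)
  · rw [k7, h.max_snd]
    exact le_min (h.le d hu) (hd d hu)
  · simp only [remaining, k3, k4]
    omega

theorem ScanInv.wp_right {n : ℕ} {p q a b r : ℕ → ℝ} {ρ : NExp → RExp} {s : State}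
    (h : ScanInv n p q a b r s) (hρ : Reads n p q ρ b) (hj : s.nat 1 1 + 1 < n)
    (hd : ∀ d, Unblocked a b n d → d ≤ b (s.nat 1 1 + 1) + partialSups a (s.nat 1 0)) :
    wp (advance ρ 1 0) (fun s' => ScanInv n p q a b r s' ∧ remaining n s' + 1 ≤ remaining n s)
      s := by
  refine wp_advance (by omega) (by omega) (by omega) hρ h.input hj rfl
    fun s' k1 k2 k3 k4 k5 k6 k7 => ?_
  have h1 := h.lt_fst
  have h2 := h.lt_snd
  refine ⟨⟨k1, k2.trans h.result, k4 ▸ h1, k3 ▸ hj, ?_, ?_, ?_, fun d hu => ?_⟩, ?_⟩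
  · rw [k6, k4, h.max_fst]
  · rw [k5, k3, partialSups_add_one, h.max_snd]
  · rw [k3, k4, k7, h.max_fst]
    exact .right (h.frontier.anti (min_le_left _ _)) (min_le_right _ _)
  · rw [k7, h.max_fst]
    exact le_min (h.le d hu) (hd d hu)
  · simp only [remaining, k3, k4]
    omega

theorem ScanInv.wp_scanStep {n : ℕ} {p q a b r : ℕ → ℝ} {α β : NExp → RExp} {s : State}
    (h : ScanInv n p q a b r s) (hα : Reads n p q α a) (hβ : Reads n p q β b)
    (hs : scanUnfinished.eval s) :
    wp (scanStep α β) (fun s' => ScanInv n p q a b r s' ∧ remaining n s' + 1 ≤ remaining n s)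
      s := by
  have hlen := h.input.len
  have h1 := h.lt_fst
  have h2 := h.lt_snd
  simp only [scanUnfinished, BExp.eval, NExp.eval, len, pos, hlen] at hs
  refine ⟨fun hj => ?_, fun hj => ⟨fun hi => ?_, fun hi => ?_⟩⟩
  · simp only [BExp.eval, NExp.eval, len, pos, hlen] at hj
    refine h.wp_left hα (by omega) fun d hu => ?_
    have := hu.left (s.nat 1 0) (by omega)
    rwa [show n - 1 = s.nat 1 1 by omega] at this
  · simp only [BExp.eval, NExp.eval, len, pos, hlen] at hi hj
    refine h.wp_right hβ (by omega) fun d hu => ?_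
    have := hu.right (s.nat 1 1) (by omega)
    rwa [show n - 1 = s.nat 1 0 by omega] at this
  · simp only [BExp.eval, NExp.eval, len, pos, hlen] at hi hj
    have ha := hα s (.add (pos 0) (.const 1)) h.input (by simp only [NExp.eval, pos]; omega)
    have hb := hβ s (.add (pos 1) (.const 1)) h.input (by simp only [NExp.eval, pos]; omega)
    simp only [NExp.eval, pos] at ha hb
    have hmax := fun d (hu : Unblocked a b n d) =>
      hu.both (s.nat 1 0) (s.nat 1 1) (by omega) (by omega)
    refine ⟨fun hle => ?_, fun hle => ?_⟩ <;>
      simp only [BExp.eval, RExp.eval, NExp.eval, reg, pos, ha, hb, h.max_fst, h.max_snd] at hle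
    · refine h.wp_left hα (by omega) fun d hu => ?_
      have := hmax d hu
      rwa [max_eq_left hle] at this
    · refine h.wp_right hβ (by omega) fun d hu => ?_
      have := hmax d hu
      rwa [max_eq_right (not_le.1 hle).le] at this

theorem wp_scanInit {n : ℕ} (hn : 1 ≤ n) {p q a b : ℕ → ℝ} {α β : NExp → RExp} {s : State}
    (hs : HoldsInput n p q s) (hα : Reads n p q α a) (hβ : Reads n p q β b) :
    wp (scanInit α β) (ScanInv n p q a b (s.real 4)) s := by
  obtain ⟨h1, h2, h3⟩ := hs
  set s₁ := (s.setNat 1 0 0).setNat 1 1 0 with hs₁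
  have hi₁ : HoldsInput n p q s₁ := ⟨by simpa [s₁, State.setNat] using h1, h2, h3⟩
  have ha : (α (.const 0)).eval s₁ = a 0 := hα s₁ (.const 0) hi₁ hn
  set s₂ := s₁.setReal 3 0 (a 0) with hs₂
  have hi₂ : HoldsInput n p q s₂ := ⟨hi₁.len, by simpa [s₂, State.setReal] using hi₁.fst,
    by simpa [s₂, State.setReal] using hi₁.snd⟩
  have hb : (β (.const 0)).eval s₂ = b 0 := hβ s₂ (.const 0) hi₂ hn
  simp only [scanInit, wp, NExp.eval, ← hs₁, ha, ← hs₂, hb]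
  refine ⟨⟨?_, ?_, ?_⟩, ?_, ?_, ?_, ?_, ?_, ?_, fun d hu => ?_⟩
  · simpa [State.setReal] using hi₂.len
  · simpa [State.setReal] using hi₂.fst
  · simpa [State.setReal] using hi₂.snd
  · simp [s₂, s₁, State.setReal, State.setNat]
  · simpa [s₂, s₁, State.setReal, State.setNat] using Nat.lt_of_succ_le hn
  · simpa [s₂, s₁, State.setReal, State.setNat] using Nat.lt_of_succ_le hn
  · simp [s₂, s₁, State.setReal, State.setNat]
  · simp [s₂, s₁, State.setReal, State.setNat]
  · have : Frontier a b (a 0 + b 0) 0 0 := .start le_rfl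
    simpa [s₂, s₁, State.setReal, State.setNat, reg, RExp.eval, NExp.eval] using this
  · simpa [s₂, s₁, State.setReal, State.setNat, reg, RExp.eval, NExp.eval] using hu.start

/-- The scan computes a scan value and leaves the input and the other results unchanged. -/
theorem haltsIn_scan {n : ℕ} (hn : 1 ≤ n) {p q a b : ℕ → ℝ} {α β : NExp → RExp} {s : State}
    (k : ℕ) (hs : HoldsInput n p q s) (hα : Reads n p q α a) (hβ : Reads n p q β b) :
    HaltsIn (scan α β k) s (scanTime α β n) (fun s' => HoldsInput n p q s' ∧
      ∃ v, IsScanValue a b n v ∧ s'.real 4 = Function.update (s.real 4) k v) := by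
  refine (haltsIn_of_wp (wp_scanInit hn hs hα hβ)).seq fun s₁ h₁ => ?_
  refine (haltsIn_loop (μ := remaining n) (fun s h hb => h.wp_scanStep hα hβ hb) s₁ h₁
    (m := 2 * n) (by simp only [remaining]; omega)).seq fun s₂ ⟨h₂, hb⟩ => ?_
  refine haltsIn_of_wp (c := .setReal 4 (.const k) (reg 2)) ?_
  obtain ⟨⟨k1, k2, k3⟩, k4, k5, k6, -, -, k9, k10⟩ := h₂
  simp only [scanUnfinished, BExp.eval, NExp.eval, len, pos, k1, not_not] at hb
  rw [show s₂.nat 1 0 = n - 1 by omega, show s₂.nat 1 1 = n - 1 by omega] at k9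
  refine ⟨⟨k1, by simpa [State.setReal] using k2, by simpa [State.setReal] using k3⟩,
    s₂.real 3 2, ⟨k9, k10⟩, ?_⟩
  simp [State.setReal, k4, NExp.eval, reg, RExp.eval]

/-! ### Reading the curves -/

/-- The index `n - 1 - e`, at which the reversed sequence is read. -/
def mirror (e : NExp) : NExp := .sub (.sub len (.const 1)) e

def neg (e : RExp) : RExp := .sub (.const 0) e

theorem Reads.mirror {n : ℕ} {p q a : ℕ → ℝ} {ρ : NExp → RExp} (h : Reads n p q ρ a) :
    Reads n p q (fun e => ρ (mirror e)) (fun i => a (n - 1 - i)) := fun s e hs he => by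
  have hm : (FlippedFrechet.mirror e).eval s = n - 1 - e.eval s := by
    simp [FlippedFrechet.mirror, NExp.eval, len, hs.len]
  rw [h s _ hs (by omega), hm]

theorem Reads.neg {n : ℕ} {p q a : ℕ → ℝ} {ρ : NExp → RExp} (h : Reads n p q ρ a) :
    Reads n p q (fun e => neg (ρ e)) (fun i => -a i) := fun s e hs he => by
  simp [FlippedFrechet.neg, RExp.eval, h s e hs he]

theorem Reads.congr {n : ℕ} {p q a b : ℕ → ℝ} {ρ : NExp → RExp} (h : Reads n p q ρ a)
    (hab : ∀ i < n, a i = b i) : Reads n p q ρ b := fun s e hs he => by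
  rw [h s e hs he, hab _ he]

/-! ### The algorithm -/

/-- Combine the four scan values in cells `0, …, 3` of the real array `4`. -/
def combine : Cmd :=
  .seq (.ite (.realLe (.get 4 (.const 1)) (.get 4 (.const 0)))
    (.setReal 4 (.const 0) (.get 4 (.const 1))) .skip) <|
  .seq (.ite (.realLe (.get 4 (.const 3)) (.get 4 (.const 2)))
    (.setReal 4 (.const 2) (.get 4 (.const 3))) .skip) <|
  .seq (.ite (.realLe (.get 4 (.const 0)) (.get 4 (.const 2)))
    (.setReal 4 (.const 0) (.get 4 (.const 2))) .skip) <|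
  .ite (.realLe (.get 4 (.const 0)) (.const 0))
    (.setReal 2 (.const 0) (.const 0)) (.setReal 2 (.const 0) (.get 4 (.const 0)))

theorem wp_combine (s : State) :
    wp combine (fun s' => output s' =
      max 0 (max (min (s.real 4 0) (s.real 4 1)) (min (s.real 4 2) (s.real 4 3)))) s := by
  simp only [combine, wp, BExp.eval, RExp.eval, NExp.eval, State.setReal, output]
  simp only [Function.update_self, Function.update_of_ne, ne_eq, OfNat.ofNat_ne_zero,
    OfNat.zero_ne_ofNat, Nat.reduceEqDiff, not_false_eq_true, Int.cast_zero]
  generalize s.real 4 0 = w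
  generalize s.real 4 1 = x
  generalize s.real 4 2 = y
  generalize s.real 4 3 = z
  constructor <;> intro h₁ <;> constructor <;> intro h₂ <;> constructor <;> intro h₃ <;>
    constructor <;> intro h₄ <;> grind

def fstEntry (e : NExp) : RExp := .get 0 e

def sndEntry (e : NExp) : RExp := .get 1 e

/-- Scan `P, -Q` and `-P, Q`, forwards and backwards, and combine the results. -/
def algorithm : Cmd :=
  .seq (scan fstEntry (fun e => neg (sndEntry e)) 0) <|
  .seq (scan (fun e => fstEntry (mirror e)) (fun e => neg (sndEntry (mirror e))) 1) <|
  .seq (scan (fun e => neg (fstEntry e)) sndEntry 2) <|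
  .seq (scan (fun e => neg (fstEntry (mirror e))) (fun e => sndEntry (mirror e)) 3) combine

/-- A bound for the running time of `algorithm` on curves of length `n`. -/
def algorithmTime (n : ℕ) : ℕ :=
  scanTime fstEntry (fun e => neg (sndEntry e)) n +
  (scanTime (fun e => fstEntry (mirror e)) (fun e => neg (sndEntry (mirror e))) n +
  (scanTime (fun e => neg (fstEntry e)) sndEntry n +
  (scanTime (fun e => neg (fstEntry (mirror e))) (fun e => sndEntry (mirror e)) n +
  maxCost combine)))

theorem haltsIn_algorithm {n : ℕ} (hn : 1 ≤ n) {P Q : ℝ → ℝ} (hP : IsPolygonalCurve n P)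
    (hQ : IsPolygonalCurve n Q) :
    HaltsIn algorithm (input n (fun i => P ((i : ℝ) + 1)) (fun i => Q ((i : ℝ) + 1)))
      (algorithmTime n) (fun s => output s = flippedFrechet n n P Q) := by
  set s₀ := input n (fun i => P ((i : ℝ) + 1)) (fun i => Q ((i : ℝ) + 1)) with hs₀
  have h₀ : HoldsInput n (s₀.real 0) (s₀.real 1) s₀ := ⟨by simp [s₀, input], rfl, rfl⟩
  have rP : Reads n (s₀.real 0) (s₀.real 1) fstEntry (vertices P) := fun s e hs he => by
    simp [fstEntry, RExp.eval, hs.fst, s₀, input, he, vertices]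
  have rQ : Reads n (s₀.real 0) (s₀.real 1) sndEntry (vertices Q) := fun s e hs he => by
    simp [sndEntry, RExp.eval, hs.snd, s₀, input, he, vertices]
  have rev : ∀ {ρ : NExp → RExp} {R : ℝ → ℝ},
      Reads n (s₀.real 0) (s₀.real 1) ρ (vertices R) →
      Reads n (s₀.real 0) (s₀.real 1) (fun e => ρ (mirror e)) (vertices (reversed n R)) :=
    fun h => h.mirror.congr fun i hi => (vertices_reversed _ hi).symm
  have rPn : Reads n (s₀.real 0) (s₀.real 1) (fun e => neg (fstEntry e))
    (vertices fun x => -P x) := rP.neg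
  have rQn : Reads n (s₀.real 0) (s₀.real 1) (fun e => neg (sndEntry e))
    (vertices fun x => -Q x) := rQ.neg
  refine (haltsIn_scan hn 0 h₀ rP rQn).seq fun s₁ ⟨h₁, v₁, hv₁, e₁⟩ => ?_
  refine (haltsIn_scan hn 1 h₁ (rev rP) (rev rQn)).seq fun s₂ ⟨h₂, v₂, hv₂, e₂⟩ => ?_
  refine (haltsIn_scan hn 2 h₂ rPn rQ).seq fun s₃ ⟨h₃, v₃, hv₃, e₃⟩ => ?_
  refine (haltsIn_scan hn 3 h₃ (rev rPn) (rev rQ)).seq fun s₄ ⟨_, v₄, hv₄, e₄⟩ => ?_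
  have h := haltsIn_of_wp (wp_combine s₄)
  rw [flippedFrechet_eq hn hP hQ hv₁ hv₂ hv₃ hv₄]
  simpa [e₄, e₃, e₂, e₁] using h

theorem exists_scanTime_eq (α β : NExp → RExp) :
    ∃ C D : ℕ, ∀ n, scanTime α β n = C * n + D :=
  ⟨(scanUnfinished.cost + 1 + maxCost (scanStep α β)) * 2, maxCost (scanInit α β) +
    (scanUnfinished.cost + 1 + maxCost (.setReal 4 (.const 0) (reg 2))), fun n => by
      simp only [scanTime]
      ring⟩

theorem exists_algorithmTime_eq : ∃ C D : ℕ, ∀ n, algorithmTime n = C * n + D := by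
  obtain ⟨C₁, D₁, h₁⟩ := exists_scanTime_eq fstEntry fun e => neg (sndEntry e)
  obtain ⟨C₂, D₂, h₂⟩ := exists_scanTime_eq (fun e => fstEntry (mirror e))
    fun e => neg (sndEntry (mirror e))
  obtain ⟨C₃, D₃, h₃⟩ := exists_scanTime_eq (fun e => neg (fstEntry e)) sndEntry
  obtain ⟨C₄, D₄, h₄⟩ := exists_scanTime_eq (fun e => neg (fstEntry (mirror e)))
    fun e => sndEntry (mirror e)
  refine ⟨C₁ + C₂ + C₃ + C₄, D₁ + D₂ + D₃ + D₄ + maxCost combine, fun n => ?_⟩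
  rw [algorithmTime, h₁, h₂, h₃, h₄]
  ring

theorem isBigO_algorithmTime : (fun n : ℕ => (algorithmTime n : ℝ)) =O[atTop]
    (fun n : ℕ => (n : ℝ) * Real.log (n : ℝ) ^ 2) := by
  obtain ⟨C, D, h⟩ := exists_algorithmTime_eq
  refine Asymptotics.IsBigO.of_bound ((C : ℝ) + D) ?_
  filter_upwards [eventually_ge_atTop 3] with n hn
  have hn' : (3 : ℝ) ≤ n := by exact_mod_cast hn
  have hlog : 1 ≤ Real.log n := by
    rw [Real.le_log_iff_exp_le (by linarith)]
    linarith [Real.exp_one_lt_d9]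
  rw [h, Real.norm_of_nonneg (by positivity), Real.norm_of_nonneg (by positivity)]
  push_cast
  have h1 : (n : ℝ) ≤ n * Real.log n ^ 2 :=
    le_mul_of_one_le_right (by linarith) (one_le_pow₀ hlog)
  have hD : (0 : ℝ) ≤ D := Nat.cast_nonneg D
  calc (C : ℝ) * n + D ≤ (C + D) * n := by nlinarith
    _ ≤ (C + D) * (n * Real.log n ^ 2) := mul_le_mul_of_nonneg_left h1 (by positivity)

end FlippedFrechet

/-- One real RAM program computes `FF(P, Q)` exactly, from the vertices of any two polygonal curves
`P, Q` of length `n` on the real line, within `T n` steps, where `T n = O(n log² n)`. -/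
theorem mainTheorem1 :
    ∃ (prog : RealRAM.Cmd) (T : ℕ → ℕ),
      (fun n : ℕ => (T n : ℝ)) =O[atTop] (fun n : ℕ => (n : ℝ) * Real.log (n : ℝ) ^ 2) ∧
      ∀ n : ℕ, 1 ≤ n → ∀ P Q : ℝ → ℝ, IsPolygonalCurve n P → IsPolygonalCurve n Q →
        ∃ (t : ℕ) (s : RealRAM.State),
          RealRAM.Exec prog
            (RealRAM.input n (fun i => P ((i : ℝ) + 1)) (fun i => Q ((i : ℝ) + 1))) t s ∧
          t ≤ T n ∧ RealRAM.output s = flippedFrechet n n P Q :=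
  ⟨FlippedFrechet.algorithm, FlippedFrechet.algorithmTime, FlippedFrechet.isBigO_algorithmTime,
    fun _ hn _ _ hP hQ => FlippedFrechet.haltsIn_algorithm hn hP hQ⟩
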